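/- Let $\mathcal X,\mathcal Y$ be measurable spaces, let $\mathcal H$ be a set of maps $h:\mathcal X\to\mathcal Y$, and let $l((x,y),h)=\mathbb 1[y\neq h(x)]$ be the zero-one loss, assumed to be measurable in $(x,y)$ for every $h\in\mathcal H$. A credal set is a closed (for setwise convergence) and convex set of probability measures on $\mathcal X\times\mathcal Y$; $\mathrm{ex}\,\mathcal P$ denotes the set of extreme elements of $\mathcal P$. For a probability measure $P$ on $\mathcal X\times\mathcal Y$ put $L_P(h)=\mathbb E_P[l((x,y),h)]$. For $n\ge 1$ put $$R_{n,P}(\mathcal A)=\mathbb E\Big[\sup_{h\in\mathcal H}\frac1n\sum_{i=1}^n\sigma_i\,l((x_i,y_i),h)\Big],\qquad \mathcal A=\{(x,y)\mapsto l((x,y),h):h\in\mathcal H\},$$ where $(x_1,y_1),\dots,(x_n,y_n)\sim P$ i.i.d. and, independently of these, $\sigma_1,\dots,\sigma_n\sim\mathrm{Unif}(\{-1,1\})$ i.i.d. For a set $\mathcal P$ of probability measures and $\delta\in(0,1)$ put $$\epsilon^{\star\star\star}_{\mathcal P}(\delta)=4\,\overline R_{n}(\mathcal P)+\sqrt{\frac{2\log(2/\delta)}{n}},\qquad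 \overline R_{n}(\mathcal P)=\sup_{P^{\mathrm{ex}}\in\mathrm{ex}\,\mathcal P}R_{n,P^{\mathrm{ex}}}(\mathcal A).$$ Let $\mathcal P=\{P^{\mathrm{true}}\}$, let $n\geq 1$, let $(x_1,y_1),\dots,(x_n,y_n)\sim P^{\mathrm{true}}$ i.i.d., and assume that the supremum in the definition of $R_{n,P^{\mathrm{true}}}(\mathcal A)$ is measurable (up to null sets) as a function of the signs and the sample. Let $\hat h\in\mathcal H$ minimize the empirical risk $\frac1n\sum_{i=1}^n l((x_i,y_i),h)$ over $h\in\mathcal H$, let $h^\star\in\mathcal H$ minimize $L_{P^{\mathrm{true}}}$ over $\mathcal H$, and let $\delta\in(0,1)$. Then $\mathcal P$ is a credal set, $\mathrm{ex}\,\mathcal P=\{P^{\mathrm{true}}\}$, $\overline R_n(\mathcal P)=R_{n,P^{\mathrm{true}}}(\mathcal A)$, and hence $$\epsilon^{\star\star\star}_{\mathcal P}(\delta)=4R_{n,P^{\mathrm{true}}}(\mathcal A)+\sqrt{\frac{2\log(2/\delta)}{n}},$$ and the credal excess-risk guarantee $$\mathbb P\big[L_{P^{\mathrm{true}}}(\hat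 h)-L_{P^{\mathrm{true}}}(h^\star)\le\epsilon^{\star\star\star}_{\mathcal P}(\delta)\big]\ge 1-\delta$$ is the classical Rademacher-complexity bound $$\mathbb P\Big[L_{P^{\mathrm{true}}}(\hat h)-L_{P^{\mathrm{true}}}(h^\star)\le 4R_{n,P^{\mathrm{true}}}(\mathcal A)+\sqrt{\tfrac{2\log(2/\delta)}{n}}\Big]\ge 1-\delta .$$ Both hold. (If $\hat h$ is chosen so that the event is not measurable, this means that the event contains a measurable event of probability at least $1-\delta$.) -/

import Mathlib

open MeasureTheory ProbabilityTheory

noncomputable section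

namespace CredalLearning

/-! ### Probabilities, credal sets and extreme elements -/

section Credal

variable {Ω : Type*} [MeasurableSpace Ω]

/-- A probability measure seen as the vector `(P A)` indexed by the measurable events `A`. This
is an injective map into a real vector space that turns mixtures into convex combinations. -/
def eventProb (P : ProbabilityMeasure Ω) : {A : Set Ω // MeasurableSet A} → ℝ :=
  fun A => (P : Measure Ω).real A

/-- The topology of setwise convergence on probability measures: the coarsest topology for which
`P ↦ P A` is continuous for every measurable event `A`. -/
abbrev setwiseTopology (Ω : Type*) [MeasurableSpace Ω] : TopologicalSpace (ProbabilityMeasure Ω) :=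
  TopologicalSpace.induced eventProb inferInstance

/-- A credal set: a closed and convex set of probability measures. -/
def IsCredalSet (C : Set (ProbabilityMeasure Ω)) : Prop :=
  @IsClosed _ (setwiseTopology Ω) C ∧ Convex ℝ (eventProb '' C)

/-- The extreme elements `ex C`: the elements of `C` that are not proper convex combinations of
other elements of `C`. -/
def extremeElements (C : Set (ProbabilityMeasure Ω)) : Set (ProbabilityMeasure Ω) :=
  {P | P ∈ C ∧ eventProb P ∈ Set.extremePoints ℝ (eventProb '' C)}

/-- The event `S` (not assumed to be measurable) occurs with probability at least `p`: it contains
a measurable event of probability at least `p`. -/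
def HoldsWithProb (μ : Measure Ω) (p : ℝ) (S : Set Ω) : Prop :=
  ∃ E : Set Ω, MeasurableSet E ∧ E ⊆ S ∧ p ≤ μ.real E

/-- For a measurable event this is the usual meaning. -/
theorem holdsWithProb_iff (μ : Measure Ω) [IsFiniteMeasure μ] (p : ℝ) {S : Set Ω}
    (hS : MeasurableSet S) : HoldsWithProb μ p S ↔ p ≤ μ.real S :=
  ⟨fun ⟨_, _, hES, hp⟩ => hp.trans (measureReal_mono hES), fun h => ⟨S, hS, subset_rfl, h⟩⟩

end Credal

/-! ### Risks and Rademacher complexities for the zero-one loss -/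

section Learning

variable {X Y : Type*}

/-- The zero-one loss `l ((x, y), h) = 𝟙[y ≠ h x]`. -/
def zeroOneLoss (z : X × Y) (h : X → Y) : ℝ :=
  Set.indicator {w : X × Y | w.2 ≠ h w.1} (fun _ => 1) z

/-- The empirical risk of `h` on the sample `z`. -/
def empiricalRisk {n : ℕ} (z : Fin n → X × Y) (h : X → Y) : ℝ :=
  (1 / (n : ℝ)) * ∑ i, zeroOneLoss (z i) h

/-- `h` minimizes the empirical risk on the sample `z` over the hypotheses space `H`. -/
def IsERM (H : Set (X → Y)) {n : ℕ} (z : Fin n → X × Y) (h : X → Y) : Prop :=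
  h ∈ H ∧ ∀ g ∈ H, empiricalRisk z h ≤ empiricalRisk z g

/-- The supremum over the loss class of the correlation with the signs `p.1` on the sample `p.2`,
that is `sup_{h ∈ H} (1/n) ∑ i, σ i * l (z i, h)` at `p = (σ, z)`. -/
def rademacherSup (H : Set (X → Y)) (n : ℕ) (p : (Fin n → ℝ) × (Fin n → X × Y)) : ℝ :=
  ⨆ h : H, (1 / (n : ℝ)) * ∑ i, p.1 i * zeroOneLoss (p.2 i) (h : X → Y)

variable [MeasurableSpace X] [MeasurableSpace Y]

/-- The expected risk `L_P(h)`. -/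
def expectedRisk (P : ProbabilityMeasure (X × Y)) (h : X → Y) : ℝ :=
  ∫ z, zeroOneLoss z h ∂(P : Measure (X × Y))

/-- `h` minimizes the expected risk under `P` over the hypotheses space `H`. -/
def IsBestModel (H : Set (X → Y)) (P : ProbabilityMeasure (X × Y)) (h : X → Y) : Prop :=
  h ∈ H ∧ ∀ g ∈ H, expectedRisk P h ≤ expectedRisk P g

/-- The joint law of `n` independent uniform random signs and an independent i.i.d. sample of
size `n` from `P`. -/
def signSampleLaw (n : ℕ) (P : ProbabilityMeasure (X × Y)) :
    Measure ((Fin n → ℝ) × (Fin n → X × Y)) :=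
  (Measure.pi fun _ : Fin n => uniformOn ({-1, 1} : Set ℝ)).prod
    (Measure.pi fun _ : Fin n => (P : Measure (X × Y)))

/-- The Rademacher complexity `R_{n,P}` of the loss class of `H`. -/
def rademacher (H : Set (X → Y)) (n : ℕ) (P : ProbabilityMeasure (X × Y)) : ℝ :=
  ∫ p, rademacherSup H n p ∂(signSampleLaw n P)

/-- The supremum of the Rademacher complexities over the extreme elements of `C`. -/
def upperRademacher (H : Set (X → Y)) (n : ℕ) (C : Set (ProbabilityMeasure (X × Y))) : ℝ :=
  sSup (rademacher H n '' extremeElements C)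

/-- The excess-risk bound `ε***(δ)` attached to the set `C` of probabilities. -/
def credalBound (H : Set (X → Y)) (n : ℕ) (C : Set (ProbabilityMeasure (X × Y))) (δ : ℝ) : ℝ :=
  4 * upperRademacher H n C + Real.sqrt (2 * Real.log (2 / δ) / n)

end Learning

end CredalLearning

end

/-! The credal statements are formal: `eventProb` is injective, so a singleton is closed and convex,
its only point is extreme, and the supremum over extreme elements has one term. What remains is the
classical bound, which is obtained with 2R in place of 4R; since R ≥ 0, this is stronger.

The uniform deviation sup_h (L_P(h) - empirical risk) need not be measurable, since only the signed
supremum is assumed to be so, and only up to null sets. It is therefore replaced by a measurable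
majorant W. With a ghost sample w and signs s, the difference of the empirical risks on w and z
splits into two signed sums, with signs s and -s, over two mixtures of z and w. Each pair (signs,
mixture) has the law defining R, so averaging the two suprema over s and w gives a W of mean exactly
2R (`exists_measurable_ge_expectedRisk_sub`).

Changing one point of z affects only one of the two mixtures, so W has differences at most 1/n,
though only on a set of full measure. McDiarmid's inequality is proved in that generality
(`measureReal_ge_le_of_ae_boundedDifferences`) and applied once, to W plus the deviation of the
fixed hypothesis `hstar`. -/

namespace CredalLearning

/-! ### Concentration under almost-everywhere bounded differences -/

/-- Hoeffding's lemma for a random variable that is not centred. -/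
theorem integral_exp_le_of_mem_Icc {α : Type*} [MeasurableSpace α] (ν : Measure α)
    [IsProbabilityMeasure ν] {F : α → ℝ} (hF : Measurable F) {a c : ℝ}
    (h : ∀ᵐ t ∂ν, F t ∈ Set.Icc a (a + c)) (r : ℝ) :
    ∫ t, Real.exp (r * F t) ∂ν ≤ Real.exp (r * ∫ t, F t ∂ν + r ^ 2 * c ^ 2 / 8) := by
  have key := (hasSubgaussianMGF_of_mem_Icc hF.aemeasurable h).mgf_le r
  rw [mgf] at key
  have e : ∀ t, Real.exp (r * F t)
      = Real.exp (r * ∫ t, F t ∂ν) * Real.exp (r * (F t - ∫ t, F t ∂ν)) := by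
    intro t; rw [← Real.exp_add]; ring_nf
  simp_rw [e]
  rw [integral_const_mul, Real.exp_add]
  refine mul_le_mul_of_nonneg_left (key.trans (le_of_eq ?_)) (Real.exp_pos _).le
  congr 1
  simp only [NNReal.coe_pow, NNReal.coe_div, coe_nnnorm, NNReal.coe_ofNat, add_sub_cancel_left,
    Real.norm_eq_abs, div_pow, sq_abs]
  ring

/-- The Hamming distance of two samples, weighted by `c`. -/
noncomputable def hammingCost {α : Type*} {n : ℕ} (c : ℝ) (z w : Fin n → α) : ℝ :=
  ∑ i, Set.indicator {p : α × α | p.1 ≠ p.2} (fun _ => c) (z i, w i)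

theorem hammingCost_cons {α : Type*} {n : ℕ} (c : ℝ) (t : α) (z w : Fin n → α) :
    hammingCost c (Matrix.vecCons t z) (Matrix.vecCons t w) = hammingCost c z w := by
  simp only [hammingCost, Fin.sum_univ_succ, Matrix.cons_val_zero, Matrix.cons_val_succ]
  simp

theorem hammingCost_cons_le {α : Type*} {n : ℕ} {c : ℝ} (hc : 0 ≤ c) (t u : α) (z : Fin n → α) :
    hammingCost c (Matrix.vecCons t z) (Matrix.vecCons u z) ≤ c := by
  simp only [hammingCost, Fin.sum_univ_succ, Matrix.cons_val_zero, Matrix.cons_val_succ]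
  simpa using Set.indicator_le_self' (f := fun _ => c) (fun _ _ => hc) (t, u)

theorem measurePreserving_cons {α : Type*} [MeasurableSpace α] (ν : Measure α)
    [IsProbabilityMeasure ν] (n : ℕ) :
    MeasurePreserving (fun p : (Fin n → α) × α => Matrix.vecCons p.2 p.1)
      ((Measure.pi fun _ => ν).prod ν) (Measure.pi fun _ => ν) := by
  have h := ((measurePreserving_piFinSuccAbove (fun _ : Fin (n + 1) => ν) 0).symm).comp
    (Measure.measurePreserving_swap (μ := Measure.pi fun _ : Fin n => ν) (ν := ν))
  convert h using 1
  ext p i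
  refine Fin.cases ?_ (fun j => ?_) i <;>
    simp [MeasurableEquiv.piFinSuccAbove, Matrix.vecCons]

theorem integrable_of_abs_le {α : Type*} [MeasurableSpace α] (ν : Measure α)
    [IsFiniteMeasure ν] {F : α → ℝ} (hF : Measurable F) {B : ℝ} (hB : ∀ t, |F t| ≤ B) :
    Integrable F ν :=
  Integrable.of_bound hF.aestronglyMeasurable B (Filter.Eventually.of_forall hB)

theorem integrable_exp_of_abs_le {α : Type*} [MeasurableSpace α] (ν : Measure α)
    [IsFiniteMeasure ν] {F : α → ℝ} (hF : Measurable F) {B : ℝ} (hB : ∀ t, |F t| ≤ B) (r : ℝ) :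
    Integrable (fun t => Real.exp (r * F t)) ν := by
  refine integrable_of_abs_le ν (by fun_prop) (B := Real.exp (|r| * B)) fun t => ?_
  rw [abs_of_pos (Real.exp_pos _)]
  refine Real.exp_le_exp.2 ((le_abs_self _).trans ?_)
  rw [abs_mul]
  exact mul_le_mul_of_nonneg_left (hB t) (abs_nonneg _)

theorem abs_integral_le_of_abs_le {α : Type*} [MeasurableSpace α] (ν : Measure α)
    [IsProbabilityMeasure ν] {F : α → ℝ} {B : ℝ} (hB : ∀ t, |F t| ≤ B) :
    |∫ t, F t ∂ν| ≤ B := by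
  simpa using norm_integral_le_of_norm_le_const (μ := ν) (f := F) (Filter.Eventually.of_forall hB)

/-- The exponential moment bound behind McDiarmid's inequality, for a function that has bounded
differences on a set of full measure. -/
theorem integral_exp_le_of_ae_boundedDifferences {α : Type*} [MeasurableSpace α] (ν : Measure α)
    [IsProbabilityMeasure ν] {B c : ℝ} (hc : 0 ≤ c) (r : ℝ) (n : ℕ) :
    ∀ (F : (Fin n → α) → ℝ), Measurable F → (∀ z, |F z| ≤ B) →
    ∀ S : Set (Fin n → α), (∀ᵐ z ∂(Measure.pi fun _ => ν), z ∈ S) →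
    (∀ z ∈ S, ∀ w ∈ S, F z ≤ F w + hammingCost c z w) →
    ∫ z, Real.exp (r * F z) ∂(Measure.pi fun _ => ν)
      ≤ Real.exp (r * ∫ z, F z ∂(Measure.pi fun _ => ν) + n * (r ^ 2 * c ^ 2 / 8)) := by
  induction n with
  | zero =>
    intro F _ _ S _ _
    simp [Measure.pi_of_empty (fun _ : Fin 0 => ν) (fun i => i.elim0)]
  | succ n ih =>
    intro F hF hB S hS hL
    have mp := measurePreserving_cons ν n
    have hFm : Measurable fun p : (Fin n → α) × α => F (Matrix.vecCons p.2 p.1) := hF.comp mp.measurable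
    have hFz : ∀ z : Fin n → α, Measurable fun t => F (Matrix.vecCons t z) := fun z =>
      hFm.comp measurable_prodMk_left
    have hint : ∀ z : Fin n → α, Integrable (fun t => F (Matrix.vecCons t z)) ν := fun z =>
      integrable_of_abs_le ν (hFz z) fun t => hB _
    set V : (Fin n → α) → ℝ := fun z => ∫ t, F (Matrix.vecCons t z) ∂ν with hV
    have hVm : Measurable V :=
      (hFm.stronglyMeasurable.integral_prod_right (ν := ν)).measurable
    have hVB : ∀ z, |V z| ≤ B := fun z => abs_integral_le_of_abs_le ν fun t => hB _
    -- By Fubini, almost every fibre over the last n coordinates lies in S up to a null set. These z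
    -- form the full-measure set on which V inherits the differences of F: F is compared at a common
    -- first coordinate t.
    have hS' : ∀ᵐ z ∂(Measure.pi fun _ : Fin n => ν), ∀ᵐ t ∂ν,
        Matrix.vecCons t z ∈ S :=
      Measure.ae_ae_of_ae_prod (p := fun p : (Fin n → α) × α => Matrix.vecCons p.2 p.1 ∈ S)
        (mp.quasiMeasurePreserving.ae hS)
    have hVL : ∀ z ∈ {z : Fin n → α | ∀ᵐ t ∂ν, Matrix.vecCons t z ∈ S},
        ∀ w ∈ {z : Fin n → α | ∀ᵐ t ∂ν, Matrix.vecCons t z ∈ S},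
        V z ≤ V w + hammingCost c z w := by
      intro z hz w hw
      have : V w + hammingCost c z w = ∫ t, (F (Matrix.vecCons t w) + hammingCost c z w) ∂ν := by
        rw [integral_add (hint w) (integrable_const _)]; simp [hV]
      rw [this]
      refine integral_mono_ae (hint z) ((hint w).add (integrable_const _)) ?_
      filter_upwards [hz, hw] with t h1 h2
      have := hL _ h1 _ h2
      rwa [hammingCost_cons] at this
    have hone : ∀ᵐ z ∂(Measure.pi fun _ : Fin n => ν),
        ∫ t, Real.exp (r * F (Matrix.vecCons t z)) ∂ν ≤ Real.exp (r * V z + r ^ 2 * c ^ 2 / 8) := by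
      filter_upwards [hS'] with z hz
      -- On such a fibre F oscillates by at most c, so it takes values in an interval of length c
      -- starting at its infimum over the part of the fibre in S, and Hoeffding's lemma applies.
      have hb : BddBelow ((fun t => F (Matrix.vecCons t z)) ''
          {t | Matrix.vecCons t z ∈ S}) :=
        ⟨-B, by rintro _ ⟨t, -, rfl⟩; exact (abs_le.1 (hB _)).1⟩
      refine integral_exp_le_of_mem_Icc ν (hFz z) (a := sInf ((fun t => F (Matrix.vecCons t z)) ''
          {t | Matrix.vecCons t z ∈ S})) ?_ r
      filter_upwards [hz] with t ht
      refine ⟨csInf_le hb ⟨t, ht, rfl⟩, ?_⟩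
      rw [← sub_le_iff_le_add]
      refine le_csInf ⟨_, t, ht, rfl⟩ ?_
      rintro _ ⟨u, hu, rfl⟩
      have := hL _ ht _ hu
      have := hammingCost_cons_le hc t u z
      simp only
      linarith
    have e1 : ∫ z, F z ∂(Measure.pi fun _ => ν) = ∫ z, V z ∂(Measure.pi fun _ : Fin n => ν) := by
      rw [← mp.map_eq, integral_map mp.measurable.aemeasurable hF.aestronglyMeasurable,
        integral_prod _ (integrable_of_abs_le _ hFm fun _ => hB _)]
    have e2 : ∫ z, Real.exp (r * F z) ∂(Measure.pi fun _ => ν)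
        = ∫ z, ∫ t, Real.exp (r * F (Matrix.vecCons t z)) ∂ν ∂(Measure.pi fun _ : Fin n => ν) := by
      rw [← mp.map_eq, integral_map mp.measurable.aemeasurable
        (by fun_prop : Measurable fun z => Real.exp (r * F z)).aestronglyMeasurable,
        integral_prod _ (integrable_exp_of_abs_le _ hFm (fun _ => hB _) r)]
    rw [e1, e2]
    calc _ ≤ ∫ z, Real.exp (r * V z + r ^ 2 * c ^ 2 / 8) ∂(Measure.pi fun _ : Fin n => ν) := by
          refine integral_mono_ae
            (integrable_exp_of_abs_le _ hFm (fun _ => hB _) r).integral_prod_left ?_ hone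
          simp_rw [Real.exp_add]
          exact (integrable_exp_of_abs_le _ hVm hVB r).mul_const _
      _ = (∫ z, Real.exp (r * V z) ∂(Measure.pi fun _ : Fin n => ν))
            * Real.exp (r ^ 2 * c ^ 2 / 8) := by
          simp_rw [Real.exp_add]; rw [integral_mul_const]
      _ ≤ Real.exp (r * ∫ z, V z ∂(Measure.pi fun _ => ν) + n * (r ^ 2 * c ^ 2 / 8))
            * Real.exp (r ^ 2 * c ^ 2 / 8) :=
          mul_le_mul_of_nonneg_right (ih V hVm hVB _ hS' hVL) (Real.exp_pos _).le
      _ = _ := by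
          rw [← Real.exp_add]; push_cast; ring_nf

/-- McDiarmid's inequality for a function that has bounded differences on a set of full
measure. -/
theorem measureReal_ge_le_of_ae_boundedDifferences {α : Type*} [MeasurableSpace α] (ν : Measure α)
    [IsProbabilityMeasure ν] {B c : ℝ} (hc : 0 < c) {n : ℕ} (hn : 0 < n)
    {F : (Fin n → α) → ℝ} (hF : Measurable F) (hB : ∀ z, |F z| ≤ B)
    {S : Set (Fin n → α)} (hS : ∀ᵐ z ∂(Measure.pi fun _ => ν), z ∈ S)
    (hL : ∀ z ∈ S, ∀ w ∈ S, F z ≤ F w + hammingCost c z w) {s : ℝ} (hs : 0 ≤ s) :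
    (Measure.pi fun _ => ν).real {z | (∫ w, F w ∂(Measure.pi fun _ => ν)) + s ≤ F z}
      ≤ Real.exp (-2 * s ^ 2 / (n * c ^ 2)) := by
  have hn' : (0 : ℝ) < n := Nat.cast_pos.2 hn
  -- This r minimizes the Chernoff exponent -r s + n r² c² / 8.
  set r : ℝ := 4 * s / (n * c ^ 2) with hr
  have h1 := measure_ge_le_exp_mul_mgf (μ := Measure.pi fun _ : Fin n => ν) (X := F) (t := r)
    ((∫ w, F w ∂(Measure.pi fun _ => ν)) + s) (by positivity)
    (integrable_exp_of_abs_le _ hF hB r)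
  refine h1.trans ?_
  have h2 := integral_exp_le_of_ae_boundedDifferences ν hc.le r n F hF hB S hS hL
  refine (mul_le_mul_of_nonneg_left h2 (Real.exp_pos _).le).trans (le_of_eq ?_)
  rw [← Real.exp_add]
  congr 1
  rw [hr]
  field_simp
  ring

/-! ### Signed loss sums and their suprema -/

theorem zeroOneLoss_mem_Icc {X Y : Type*} (z : X × Y) (h : X → Y) :
    zeroOneLoss z h ∈ Set.Icc (0 : ℝ) 1 := by
  unfold zeroOneLoss
  by_cases hz : z ∈ {w : X × Y | w.2 ≠ h w.1} <;> simp only [Set.indicator, hz] <;> simp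

/-- The correlation of the losses of `h` on the sample `z` with the weights `s`. -/
noncomputable def lossCorrelation {X Y : Type*} {n : ℕ} (s : Fin n → ℝ) (z : Fin n → X × Y)
    (h : X → Y) : ℝ :=
  (1 / (n : ℝ)) * ∑ i, s i * zeroOneLoss (z i) h

/-- The vectors of signs. -/
def signVectors (n : ℕ) : Set (Fin n → ℝ) := {s | ∀ i, s i = 1 ∨ s i = -1}

theorem neg_mem_signVectors {n : ℕ} {s : Fin n → ℝ} (hs : s ∈ signVectors n) :
    -s ∈ signVectors n := fun i => by
  rcases hs i with h | h <;> simp [h]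

theorem abs_lossCorrelation_le {X Y : Type*} {n : ℕ} {s : Fin n → ℝ} (hs : s ∈ signVectors n)
    (z : Fin n → X × Y) (h : X → Y) : |lossCorrelation s z h| ≤ 1 := by
  rcases Nat.eq_zero_or_pos n with rfl | hn
  · simp [lossCorrelation]
  have hn' : (0 : ℝ) < n := Nat.cast_pos.2 hn
  have key : |∑ i, s i * zeroOneLoss (z i) h| ≤ n := by
    refine (Finset.abs_sum_le_sum_abs _ _).trans ?_
    refine (Finset.sum_le_card_nsmul _ _ 1 fun i _ => ?_).trans (by simp)
    have := zeroOneLoss_mem_Icc (z i) h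
    rw [abs_mul, abs_of_nonneg this.1]
    rcases hs i with e | e <;> simpa [e] using this.2
  rw [lossCorrelation, abs_mul, abs_of_pos (by positivity), one_div, inv_mul_le_iff₀ hn', mul_one]
  exact key

theorem mul_zeroOneLoss_le_add_indicator {X Y : Type*} {c : ℝ} (hc : c = 1 ∨ c = -1)
    (z w : X × Y) (h : X → Y) :
    c * zeroOneLoss z h ≤ c * zeroOneLoss w h
      + Set.indicator {p : (X × Y) × (X × Y) | p.1 ≠ p.2} (fun _ => (1 : ℝ)) (z, w) := by
  by_cases e : z = w
  · simp [e]
  · have h1 := zeroOneLoss_mem_Icc z h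
    have h2 := zeroOneLoss_mem_Icc w h
    rw [Set.indicator_of_mem (by simpa using e)]
    rcases hc with rfl | rfl <;> linarith [h1.1, h1.2, h2.1, h2.2]

theorem hammingCost_eq_mul {α : Type*} {n : ℕ} (c : ℝ) (z w : Fin n → α) :
    hammingCost c z w
      = c * ∑ i, Set.indicator {p : α × α | p.1 ≠ p.2} (fun _ => (1 : ℝ)) (z i, w i) := by
  rw [hammingCost, Finset.mul_sum]
  refine Finset.sum_congr rfl fun i _ => ?_
  by_cases e : z i = w i <;> simp [e]

theorem lossCorrelation_le_add_hammingCost {X Y : Type*} {n : ℕ} {s : Fin n → ℝ}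
    (hs : s ∈ signVectors n) (z w : Fin n → X × Y) (h : X → Y) :
    lossCorrelation s z h ≤ lossCorrelation s w h + hammingCost (1 / (n : ℝ)) z w := by
  rw [hammingCost_eq_mul, lossCorrelation, lossCorrelation, ← mul_add, ← Finset.sum_add_distrib]
  exact mul_le_mul_of_nonneg_left
    (Finset.sum_le_sum fun i _ => mul_zeroOneLoss_le_add_indicator (hs i) _ _ h) (by positivity)

theorem lossCorrelation_le_rademacherSup {X Y : Type*} {H : Set (X → Y)} {n : ℕ} {s : Fin n → ℝ}
    (hs : s ∈ signVectors n) (z : Fin n → X × Y) {h : X → Y} (hh : h ∈ H) :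
    lossCorrelation s z h ≤ rademacherSup H n (s, z) :=
  le_ciSup (f := fun h : H => lossCorrelation s z (h : X → Y))
    -- Boundedness must be supplied: an unbounded real supremum would default to 0.
    ⟨1, by rintro _ ⟨g, rfl⟩; exact (abs_le.1 (abs_lossCorrelation_le hs z g)).2⟩ ⟨h, hh⟩

theorem abs_rademacherSup_le {X Y : Type*} {H : Set (X → Y)} (hH : H.Nonempty) {n : ℕ}
    {s : Fin n → ℝ} (hs : s ∈ signVectors n) (z : Fin n → X × Y) :
    |rademacherSup H n (s, z)| ≤ 1 := by
  obtain ⟨h, hh⟩ := hH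
  have : Nonempty H := ⟨⟨h, hh⟩⟩
  refine abs_le.2 ⟨?_, ciSup_le fun g => (abs_le.1 (abs_lossCorrelation_le hs z g)).2⟩
  exact (abs_le.1 (abs_lossCorrelation_le hs z h)).1.trans
    (lossCorrelation_le_rademacherSup hs z hh)

theorem rademacherSup_le_add_hammingCost {X Y : Type*} {H : Set (X → Y)} (hH : H.Nonempty)
    {n : ℕ} {s : Fin n → ℝ} (hs : s ∈ signVectors n) (z w : Fin n → X × Y) :
    rademacherSup H n (s, z) ≤ rademacherSup H n (s, w) + hammingCost (1 / (n : ℝ)) z w := by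
  have : Nonempty H := hH.to_subtype
  refine ciSup_le fun g => (lossCorrelation_le_add_hammingCost hs z w g).trans ?_
  gcongr
  exact lossCorrelation_le_rademacherSup hs w g.2

/-! ### Exchanging points with a ghost sample -/

/-- The sample that takes its `i`-th point from `w` if `s i = 1` and from `z` otherwise. -/
noncomputable def sampleMix {α : Type*} {n : ℕ} (s : Fin n → ℝ) (z w : Fin n → α) : Fin n → α :=
  fun i => if s i = 1 then w i else z i

/-- At each index exactly one of s, -s is +1. That mixture contributes the loss at `w i` with sign
+, the other the loss at `z i` with sign -. -/
theorem empiricalRisk_sub_eq {X Y : Type*} {n : ℕ} {s : Fin n → ℝ} (hs : s ∈ signVectors n)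
    (z w : Fin n → X × Y) (h : X → Y) :
    empiricalRisk w h - empiricalRisk z h =
      lossCorrelation s (sampleMix s z w) h + lossCorrelation (-s) (sampleMix (-s) z w) h := by
  rw [empiricalRisk, empiricalRisk, lossCorrelation, lossCorrelation, ← mul_sub, ← mul_add,
    ← Finset.sum_sub_distrib, ← Finset.sum_add_distrib]
  congr 1
  refine Finset.sum_congr rfl fun i _ => ?_
  rcases hs i with e | e
  · simp [sampleMix, e, show ¬ ((-1 : ℝ) = 1) by norm_num]; ring
  · simp [sampleMix, e, show ¬ ((-1 : ℝ) = 1) by norm_num]; ring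

/-- Each point of z enters exactly one of the two mixtures. This keeps the differences of W at 1/n
rather than 2/n. -/
theorem hammingCost_sampleMix {α : Type*} {n : ℕ} (c : ℝ) {s : Fin n → ℝ}
    (hs : s ∈ signVectors n) (z z' w : Fin n → α) :
    hammingCost c (sampleMix s z w) (sampleMix s z' w)
      + hammingCost c (sampleMix (-s) z w) (sampleMix (-s) z' w) = hammingCost c z z' := by
  rw [hammingCost, hammingCost, hammingCost, ← Finset.sum_add_distrib]
  refine Finset.sum_congr rfl fun i _ => ?_
  rcases hs i with e | e <;> simp [sampleMix, e, show ¬ ((-1 : ℝ) = 1) by norm_num]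

theorem measurable_sampleMix {α : Type*} [MeasurableSpace α] (n : ℕ) :
    Measurable fun p : (Fin n → ℝ) × ((Fin n → α) × (Fin n → α)) =>
      sampleMix p.1 p.2.1 p.2.2 := by
  refine measurable_pi_lambda _ fun i => ?_
  unfold sampleMix
  refine Measurable.ite ?_ (by fun_prop) (by fun_prop)
  exact (measurableSet_singleton (1 : ℝ)).preimage
    (by fun_prop : Measurable fun p : (Fin n → ℝ) × ((Fin n → α) × (Fin n → α)) => p.1 i)

/-- The preimage of a box is a product of two boxes, and at each index one of the two factors is the
whole space. -/
theorem map_sampleMix {α : Type*} [MeasurableSpace α] (ν : Measure α) [IsProbabilityMeasure ν]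
    {n : ℕ} (s : Fin n → ℝ) :
    ((Measure.pi fun _ : Fin n => ν).prod (Measure.pi fun _ : Fin n => ν)).map
      (fun p => sampleMix s p.1 p.2) = Measure.pi fun _ => ν := by
  refine (Measure.pi_eq fun B hB => ?_).symm
  have hm : Measurable fun p : (Fin n → α) × (Fin n → α) => sampleMix s p.1 p.2 :=
    (measurable_sampleMix n).comp measurable_prodMk_left
  rw [Measure.map_apply hm (MeasurableSet.univ_pi hB)]
  have e : (fun p : (Fin n → α) × (Fin n → α) => sampleMix s p.1 p.2) ⁻¹' Set.univ.pi B =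
      (Set.univ.pi fun i => if s i = 1 then Set.univ else B i) ×ˢ
        (Set.univ.pi fun i => if s i = 1 then B i else Set.univ) := by
    ext p
    simp only [Set.mem_preimage, Set.mem_univ_pi, Set.mem_prod, sampleMix, ← forall_and]
    refine forall_congr' fun i => ?_
    split_ifs <;> simp
  rw [e, Measure.prod_prod, Measure.pi_pi, Measure.pi_pi, ← Finset.prod_mul_distrib]
  refine Finset.prod_congr rfl fun i _ => ?_
  split_ifs <;> simp

/-- The law of `n` independent uniform signs. -/
noncomputable abbrev signLaw (n : ℕ) : Measure (Fin n → ℝ) :=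
  Measure.pi fun _ : Fin n => uniformOn ({-1, 1} : Set ℝ)

instance isProbabilityMeasure_uniformOn_signs :
    IsProbabilityMeasure (uniformOn ({-1, 1} : Set ℝ)) :=
  isProbabilityMeasure_uniformOn (Set.toFinite _) ⟨1, by simp⟩

theorem ae_mem_signVectors (n : ℕ) : ∀ᵐ s ∂signLaw n, s ∈ signVectors n := by
  refine ae_all_iff.2 fun i => ?_
  have h : ∀ᵐ x ∂uniformOn ({-1, 1} : Set ℝ), x = 1 ∨ x = -1 := by
    have := ae_cond_mem (μ := (Measure.count : Measure ℝ)) (s := ({-1, 1} : Set ℝ))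
      (Set.toFinite _).measurableSet
    filter_upwards [this] with x hx
    simpa [or_comm] using hx
  exact (measurePreserving_eval (fun _ : Fin n => uniformOn ({-1, 1} : Set ℝ))
    i).quasiMeasurePreserving.ae h

theorem measurePreserving_neg_signLaw (n : ℕ) :
    MeasurePreserving (fun s : Fin n → ℝ => -s) (signLaw n) (signLaw n) := by
  refine measurePreserving_pi _ _ (f := fun _ x => -x) fun _ => ⟨measurable_neg, ?_⟩
  ext A hA
  rw [Measure.map_apply measurable_neg hA, uniformOn, cond_apply (Set.toFinite _).measurableSet,
    cond_apply (Set.toFinite _).measurableSet]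
  congr 1
  rw [← Measure.count_injective_image neg_injective ({-1, 1} ∩ A)]
  congr 1
  ext x
  simp only [Set.image_neg_eq_neg, Set.mem_inter_iff, Set.mem_insert_iff, Set.mem_singleton_iff,
    Set.mem_preimage, Set.mem_neg, neg_inj, neg_eq_iff_eq_neg (b := (1 : ℝ)), or_comm]

/-- For every fixed s the mixture has the i.i.d. law, so it is independent of the signs. -/
theorem measurePreserving_sign_sampleMix {α : Type*} [MeasurableSpace α] (ν : Measure α)
    [IsProbabilityMeasure ν] (n : ℕ) :
    MeasurePreserving
      (fun p : (Fin n → α) × ((Fin n → ℝ) × (Fin n → α)) => (p.2.1, sampleMix p.2.1 p.1 p.2.2))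
      ((Measure.pi fun _ => ν).prod ((signLaw n).prod (Measure.pi fun _ => ν)))
      ((signLaw n).prod (Measure.pi fun _ => ν)) := by
  set π : Measure (Fin n → α) := Measure.pi fun _ => ν
  have h1 : MeasurePreserving (fun p : (Fin n → ℝ) × ((Fin n → α) × (Fin n → α)) =>
      (p.1, sampleMix p.1 p.2.1 p.2.2)) ((signLaw n).prod (π.prod π)) ((signLaw n).prod π) :=
    (MeasurePreserving.id (signLaw n)).skew_product
      (g := fun s (p : (Fin n → α) × (Fin n → α)) => sampleMix s p.1 p.2) (measurable_sampleMix n)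
      (Filter.Eventually.of_forall fun s => map_sampleMix ν s)
  have h2 := (measurePreserving_prodAssoc (signLaw n) π π).comp
    (((Measure.measurePreserving_swap (μ := π) (ν := signLaw n)).prod
      (MeasurePreserving.id π)).comp
      ((measurePreserving_prodAssoc π (signLaw n) π).symm))
  exact h1.comp h2

theorem measurePreserving_neg_sign_sampleMix {α : Type*} [MeasurableSpace α] (ν : Measure α)
    [IsProbabilityMeasure ν] (n : ℕ) :
    MeasurePreserving
      (fun p : (Fin n → α) × ((Fin n → ℝ) × (Fin n → α)) =>
        (-p.2.1, sampleMix (-p.2.1) p.1 p.2.2))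
      ((Measure.pi fun _ => ν).prod ((signLaw n).prod (Measure.pi fun _ => ν)))
      ((signLaw n).prod (Measure.pi fun _ => ν)) :=
  (measurePreserving_sign_sampleMix ν n).comp
    ((MeasurePreserving.id (Measure.pi fun _ : Fin n => ν)).prod
      ((measurePreserving_neg_signLaw n).prod (MeasurePreserving.id (Measure.pi fun _ => ν))))

instance isProbabilityMeasure_signSampleLaw {X Y : Type*} [MeasurableSpace X] [MeasurableSpace Y]
    (n : ℕ) (P : ProbabilityMeasure (X × Y)) : IsProbabilityMeasure (signSampleLaw n P) :=
  inferInstanceAs (IsProbabilityMeasure ((signLaw n).prod _))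

theorem ae_fst_mem_signVectors {X Y : Type*} [MeasurableSpace X] [MeasurableSpace Y]
    (n : ℕ) (P : ProbabilityMeasure (X × Y)) :
    ∀ᵐ p ∂signSampleLaw n P, p.1 ∈ signVectors n :=
  Measure.quasiMeasurePreserving_fst.ae (ae_mem_signVectors n)

/-! ### Measurable majorant and symmetrization -/

/-- The supremum in the Rademacher complexity agrees almost everywhere with a measurable bounded
function that dominates it at all vectors of signs. -/
theorem exists_measurable_ge_rademacherSup {X Y : Type*} [MeasurableSpace X] [MeasurableSpace Y]
    {H : Set (X → Y)} (hH : H.Nonempty) {n : ℕ} {P : ProbabilityMeasure (X × Y)}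
    (hR : AEMeasurable (rademacherSup H n) (signSampleLaw n P)) :
    ∃ g : (Fin n → ℝ) × (Fin n → X × Y) → ℝ, Measurable g ∧ (∀ p, |g p| ≤ 1) ∧
      (∀ s ∈ signVectors n, ∀ z, rademacherSup H n (s, z) ≤ g (s, z)) ∧
      ∀ᵐ p ∂signSampleLaw n P, g p = rademacherSup H n p := by
  classical
  have hnull := (ae_fst_mem_signVectors n P).and hR.ae_eq_mk
  obtain ⟨N, hN, hNm, hN0⟩ := exists_measurable_superset_of_null (ae_iff.1 hnull)
  have hout : ∀ p, p ∉ N → p.1 ∈ signVectors n ∧ rademacherSup H n p = hR.mk _ p :=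
    fun p hp => not_not.1 fun h => hp (hN h)
  -- On the measurable null set N the value 1 dominates the supremum, which is at most 1 at sign
  -- vectors; off N the measurable version is exact.
  refine ⟨N.piecewise (fun _ => 1) (hR.mk _),
    Measurable.piecewise hNm measurable_const hR.measurable_mk, fun p => ?_, fun s hs z => ?_, ?_⟩
  · by_cases hp : p ∈ N
    · simp [hp]
    · rw [Set.piecewise_eq_of_notMem _ _ _ hp, ← (hout p hp).2]
      exact abs_rademacherSup_le hH (hout p hp).1 p.2
  · by_cases hp : (s, z) ∈ N
    · rw [Set.piecewise_eq_of_mem _ _ _ hp]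
      exact (abs_le.1 (abs_rademacherSup_le hH hs z)).2
    · rw [Set.piecewise_eq_of_notMem _ _ _ hp, ← (hout _ hp).2]
  · filter_upwards [measure_eq_zero_iff_ae_notMem.1 hN0] with p hp
    rw [Set.piecewise_eq_of_notMem _ _ _ hp, ← (hout _ hp).2]

theorem integrable_zeroOneLoss {X Y : Type*} [MeasurableSpace X] [MeasurableSpace Y] {h : X → Y}
    (hh : Measurable fun z : X × Y => zeroOneLoss z h) (P : ProbabilityMeasure (X × Y)) :
    Integrable (fun z => zeroOneLoss z h) (P : Measure (X × Y)) :=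
  integrable_of_abs_le _ hh (B := 1) fun z => by
    have := zeroOneLoss_mem_Icc z h
    rw [abs_of_nonneg this.1]; exact this.2

theorem measurable_empiricalRisk {X Y : Type*} [MeasurableSpace X] [MeasurableSpace Y] {h : X → Y}
    (hh : Measurable fun z : X × Y => zeroOneLoss z h) (n : ℕ) :
    Measurable fun z : Fin n → X × Y => empiricalRisk z h := by
  unfold empiricalRisk
  exact (Finset.measurable_sum _ fun i _ => hh.comp (measurable_pi_apply i)).const_mul _

theorem empiricalRisk_eq_lossCorrelation {X Y : Type*} {n : ℕ} (z : Fin n → X × Y) (h : X → Y) :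
    empiricalRisk z h = lossCorrelation 1 z h := by
  simp [empiricalRisk, lossCorrelation]

theorem one_mem_signVectors (n : ℕ) : (1 : Fin n → ℝ) ∈ signVectors n := fun _ => Or.inl rfl

theorem abs_empiricalRisk_le {X Y : Type*} {n : ℕ} (z : Fin n → X × Y) (h : X → Y) :
    |empiricalRisk z h| ≤ 1 := by
  rw [empiricalRisk_eq_lossCorrelation]
  exact abs_lossCorrelation_le (one_mem_signVectors n) z h

theorem integral_empiricalRisk {X Y : Type*} [MeasurableSpace X] [MeasurableSpace Y] {h : X → Y}
    (hh : Measurable fun z : X × Y => zeroOneLoss z h) {n : ℕ} (hn : 0 < n)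
    (P : ProbabilityMeasure (X × Y)) :
    ∫ z, empiricalRisk z h ∂(Measure.pi fun _ : Fin n => (P : Measure (X × Y)))
      = expectedRisk P h := by
  have hn' : (n : ℝ) ≠ 0 := Nat.cast_ne_zero.2 hn.ne'
  unfold empiricalRisk
  rw [integral_const_mul, integral_finsetSum _ fun i _ => ?_]
  · have : ∀ i : Fin n, ∫ z : Fin n → X × Y, zeroOneLoss (z i) h
        ∂(Measure.pi fun _ : Fin n => (P : Measure (X × Y))) = expectedRisk P h := fun i =>
      integral_comp_eval (μ := fun _ : Fin n => (P : Measure (X × Y)))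
        (f := fun z => zeroOneLoss z h) hh.aestronglyMeasurable
    simp only [this, Finset.sum_const, Finset.card_univ, Fintype.card_fin, nsmul_eq_mul]
    field_simp
  · exact (measurePreserving_eval (fun _ : Fin n => (P : Measure (X × Y)))
      i).integrable_comp_of_integrable (integrable_zeroOneLoss hh P)

/-- Symmetrization: the deviations of the expected risks from the empirical risks are dominated,
uniformly over the hypotheses, by a measurable function with mean twice the Rademacher complexity
that has bounded differences on a set of full measure. -/
theorem exists_measurable_ge_expectedRisk_sub {X Y : Type*} [MeasurableSpace X]
    [MeasurableSpace Y] {H : Set (X → Y)} (hne : H.Nonempty)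
    (hH : ∀ h ∈ H, Measurable fun z : X × Y => zeroOneLoss z h)
    {n : ℕ} (hn : 0 < n) {P : ProbabilityMeasure (X × Y)}
    (hR : AEMeasurable (rademacherSup H n) (signSampleLaw n P)) :
    ∃ (W : (Fin n → X × Y) → ℝ) (S : Set (Fin n → X × Y)), Measurable W ∧ (∀ z, |W z| ≤ 2) ∧
      (∀ᵐ z ∂(Measure.pi fun _ => (P : Measure (X × Y))), z ∈ S) ∧
      (∀ z ∈ S, ∀ z' ∈ S, W z ≤ W z' + hammingCost (1 / (n : ℝ)) z z') ∧
      (∀ z, ∀ h ∈ H, expectedRisk P h - empiricalRisk z h ≤ W z) ∧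
      ∫ z, W z ∂(Measure.pi fun _ => (P : Measure (X × Y))) = 2 * rademacher H n P := by
  obtain ⟨g, hgm, hgB, hge, hgae⟩ := exists_measurable_ge_rademacherSup hne hR
  set ν : Measure (X × Y) := (P : Measure (X × Y))
  set π : Measure (Fin n → X × Y) := Measure.pi fun _ => ν with hπ
  have m1 := measurePreserving_sign_sampleMix ν n
  have m2 := measurePreserving_neg_sign_sampleMix ν n
  set U : (Fin n → X × Y) × ((Fin n → ℝ) × (Fin n → X × Y)) → ℝ := fun p =>
    g (p.2.1, sampleMix p.2.1 p.1 p.2.2) + g (-p.2.1, sampleMix (-p.2.1) p.1 p.2.2) with hU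
  have hUm : Measurable U := (hgm.comp m1.measurable).add (hgm.comp m2.measurable)
  have hUB : ∀ p, |U p| ≤ 2 := fun p =>
    (abs_add_le _ _).trans ((add_le_add (hgB _) (hgB _)).trans (by norm_num))
  have hUz : ∀ z, Integrable (fun q => U (z, q)) ((signLaw n).prod π) := fun z =>
    integrable_of_abs_le _ (hUm.comp measurable_prodMk_left) fun q => hUB _
  have hsign : ∀ᵐ q ∂((signLaw n).prod π), q.1 ∈ signVectors n := ae_fst_mem_signVectors n P
  -- W averages U over the signs and the ghost sample. S collects the samples for which g equals the
  -- true supremum at both mixtures for almost every q; only there are the differences of W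
  -- controlled.
  refine ⟨fun z => ∫ q, U (z, q) ∂((signLaw n).prod π),
    {z | ∀ᵐ q ∂((signLaw n).prod π),
      g (q.1, sampleMix q.1 z q.2) = rademacherSup H n (q.1, sampleMix q.1 z q.2) ∧
      g (-q.1, sampleMix (-q.1) z q.2) = rademacherSup H n (-q.1, sampleMix (-q.1) z q.2)},
    (hUm.stronglyMeasurable.integral_prod_right (ν := (signLaw n).prod π)).measurable,
    fun z => abs_integral_le_of_abs_le _ fun q => hUB _, ?_, ?_, ?_, ?_⟩
  · exact Measure.ae_ae_of_ae_prod
      ((m1.quasiMeasurePreserving.ae hgae).and (m2.quasiMeasurePreserving.ae hgae))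
  · intro z hz z' hz'
    have e : ∫ q, U (z', q) ∂((signLaw n).prod π) + hammingCost (1 / (n : ℝ)) z z'
        = ∫ q, (U (z', q) + hammingCost (1 / (n : ℝ)) z z') ∂((signLaw n).prod π) := by
      rw [integral_add (hUz z') (integrable_const _)]; simp
    rw [e]
    refine integral_mono_ae (hUz z) ((hUz z').add (integrable_const _)) ?_
    filter_upwards [hz, hz', hsign] with q h1 h2 hs
    simp only [hU]
    rw [h1.1, h1.2, h2.1, h2.2, ← hammingCost_sampleMix _ hs z z' q.2]
    have a1 := rademacherSup_le_add_hammingCost hne hs (sampleMix q.1 z q.2) (sampleMix q.1 z' q.2)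
    have a2 := rademacherSup_le_add_hammingCost hne (neg_mem_signVectors hs)
      (sampleMix (-q.1) z q.2) (sampleMix (-q.1) z' q.2)
    linarith
  · intro z h hh
    have hi : Integrable (fun w : Fin n → X × Y => empiricalRisk w h) π :=
      integrable_of_abs_le _ (measurable_empiricalRisk (hH h hh) n) fun w =>
        abs_empiricalRisk_le w h
    have hi' : Integrable (fun q : (Fin n → ℝ) × (Fin n → X × Y) => empiricalRisk q.2 h)
        ((signLaw n).prod π) := hi.comp_snd _
    -- The expected risk is the mean empirical risk of the ghost sample. As g dominates at every
    -- sign vector, the comparison holds for every z, so no sample is exceptional for a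
    -- data-dependent h.
    have e : expectedRisk P h - empiricalRisk z h
        = ∫ q, (empiricalRisk q.2 h - empiricalRisk z h) ∂((signLaw n).prod π) := by
      rw [integral_sub hi' (integrable_const _), integral_fun_snd (μ := signLaw n)
        (fun w : Fin n → X × Y => empiricalRisk w h), integral_empiricalRisk (hH h hh) hn P]
      simp
    rw [e]
    refine integral_mono_ae (hi'.sub (integrable_const _)) (hUz z) ?_
    filter_upwards [hsign] with q hs
    rw [empiricalRisk_sub_eq hs]
    exact add_le_add
      ((lossCorrelation_le_rademacherSup hs _ hh).trans (hge _ hs _))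
      ((lossCorrelation_le_rademacherSup (neg_mem_signVectors hs) _ hh).trans
        (hge _ (neg_mem_signVectors hs) _))
  · have hg : ∫ p, g p ∂((signLaw n).prod π) = rademacher H n P := integral_congr_ae hgae
    have hgi : Integrable g ((signLaw n).prod π) := integrable_of_abs_le _ hgm hgB
    rw [← integral_prod _ (integrable_of_abs_le _ hUm hUB)]
    have i1 : ∫ p, g (p.2.1, sampleMix p.2.1 p.1 p.2.2) ∂(π.prod ((signLaw n).prod π))
        = rademacher H n P := by
      have := integral_map (μ := π.prod ((signLaw n).prod π)) m1.measurable.aemeasurable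
        (hgm.aestronglyMeasurable (μ := _))
      rw [m1.map_eq] at this
      exact this.symm.trans hg
    have i2 : ∫ p, g (-p.2.1, sampleMix (-p.2.1) p.1 p.2.2) ∂(π.prod ((signLaw n).prod π))
        = rademacher H n P := by
      have := integral_map (μ := π.prod ((signLaw n).prod π)) m2.measurable.aemeasurable
        (hgm.aestronglyMeasurable (μ := _))
      rw [m2.map_eq] at this
      exact this.symm.trans hg
    have i3 := integral_add (m1.integrable_comp_of_integrable hgi)
      (m2.integrable_comp_of_integrable hgi)
    exact i3.trans ((congrArg₂ (· + ·) i1 i2).trans (two_mul _).symm)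

/-! ### Singleton credal sets -/

theorem eventProb_injective {Ω : Type*} [MeasurableSpace Ω] :
    Function.Injective (eventProb (Ω := Ω)) := by
  intro P Q h
  apply Subtype.ext
  ext A hA
  have hP : IsProbabilityMeasure (P : Measure Ω) := P.2
  have hQ : IsProbabilityMeasure (Q : Measure Ω) := Q.2
  have := congrFun h ⟨A, hA⟩
  simp only [eventProb, measureReal_def] at this
  exact (ENNReal.toReal_eq_toReal_iff' (measure_ne_top (P : Measure Ω) A)
    (measure_ne_top (Q : Measure Ω) A)).1 this

/-- Closedness holds because the setwise topology is induced by an injective map into a Hausdorff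
space. -/
theorem isCredalSet_singleton {Ω : Type*} [MeasurableSpace Ω] (P : ProbabilityMeasure Ω) :
    IsCredalSet {P} := by
  refine ⟨?_, by rw [Set.image_singleton]; exact convex_singleton _⟩
  rw [isClosed_induced_iff]
  refine ⟨{eventProb P}, isClosed_singleton, ?_⟩
  ext Q
  simp [eventProb_injective.eq_iff]

theorem extremeElements_singleton {Ω : Type*} [MeasurableSpace Ω] (P : ProbabilityMeasure Ω) :
    extremeElements {P} = {P} := by
  ext Q
  simp only [extremeElements, Set.image_singleton, extremePoints_singleton, Set.mem_ofPred_eq,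
    Set.mem_singleton_iff, eventProb_injective.eq_iff, and_self]

theorem upperRademacher_singleton {X Y : Type*} [MeasurableSpace X] [MeasurableSpace Y]
    (H : Set (X → Y)) (n : ℕ) (P : ProbabilityMeasure (X × Y)) :
    upperRademacher H n {P} = rademacher H n P := by
  rw [upperRademacher, extremeElements_singleton, Set.image_singleton, csSup_singleton]

/-! ### Excess risk of an empirical risk minimizer -/

theorem HoldsWithProb.mono {Ω : Type*} [MeasurableSpace Ω] {μ : Measure Ω} {p : ℝ} {S T : Set Ω}
    (h : HoldsWithProb μ p S) (hST : S ⊆ T) : HoldsWithProb μ p T := by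
  obtain ⟨E, hE, hES, hp⟩ := h
  exact ⟨E, hE, hES.trans hST, hp⟩

/-- For any fixed h the deviation of the expected from the empirical risk has mean 0 and is
dominated by W, whose mean is 2R. -/
theorem rademacher_nonneg {X Y : Type*} [MeasurableSpace X] [MeasurableSpace Y]
    {H : Set (X → Y)} (hne : H.Nonempty)
    (hH : ∀ h ∈ H, Measurable fun z : X × Y => zeroOneLoss z h)
    {n : ℕ} (hn : 0 < n) {P : ProbabilityMeasure (X × Y)}
    (hR : AEMeasurable (rademacherSup H n) (signSampleLaw n P)) : 0 ≤ rademacher H n P := by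
  obtain ⟨W, S, hWm, hWB, -, -, hWge, hWi⟩ := exists_measurable_ge_expectedRisk_sub hne hH hn hR
  obtain ⟨h, hh⟩ := hne
  have hi : Integrable (fun w : Fin n → X × Y => empiricalRisk w h)
      (Measure.pi fun _ => (P : Measure (X × Y))) :=
    integrable_of_abs_le _ (measurable_empiricalRisk (hH h hh) n) fun w => abs_empiricalRisk_le w h
  have := integral_mono ((integrable_const (expectedRisk P h)).sub hi)
    (integrable_of_abs_le (Measure.pi fun _ => (P : Measure (X × Y))) hWm hWB)
    fun z => hWge z h hh
  simp only [Pi.sub_apply] at this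
  rw [integral_sub (integrable_const _) hi, integral_empiricalRisk (hH h hh) hn P, hWi] at this
  simp at this
  exact this

/-- The excess risk of an empirical risk minimizer exceeds twice the Rademacher complexity by at
most the confidence term. -/
theorem holdsWithProb_excessRisk_le {X Y : Type*} [MeasurableSpace X] [MeasurableSpace Y]
    {H : Set (X → Y)} (hH : ∀ h ∈ H, Measurable fun z : X × Y => zeroOneLoss z h)
    {P : ProbabilityMeasure (X × Y)} {n : ℕ} (hn : 0 < n)
    (hR : AEMeasurable (rademacherSup H n) (signSampleLaw n P))
    {Ω : Type*} [MeasurableSpace Ω] {μ : Measure Ω} [IsProbabilityMeasure μ]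
    {Z : Fin n → Ω → X × Y} (hZ : ∀ i, Measurable (Z i)) (hindep : iIndepFun Z μ)
    (hlaw : ∀ i, μ.map (Z i) = (P : Measure (X × Y)))
    {hhat : Ω → X → Y} (hhat_erm : ∀ ω, IsERM H (fun i => Z i ω) (hhat ω))
    {hstar : X → Y} (hstar_mem : hstar ∈ H) {δ : ℝ} (hδ : δ ∈ Set.Ioo (0 : ℝ) 1) :
    HoldsWithProb μ (1 - δ) {ω | expectedRisk P (hhat ω) - expectedRisk P hstar ≤
      2 * rademacher H n P + Real.sqrt (2 * Real.log (2 / δ) / n)} := by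
  obtain ⟨W, S, hWm, hWB, hS, hWL, hWge, hWi⟩ :=
    exists_measurable_ge_expectedRisk_sub ⟨hstar, hstar_mem⟩ hH hn hR
  have hn' : (0 : ℝ) < n := Nat.cast_pos.2 hn
  set ν : Measure (X × Y) := (P : Measure (X × Y))
  set s : ℝ := Real.sqrt (2 * Real.log (2 / δ) / n) with hs
  have hem := measurable_empiricalRisk (hH hstar hstar_mem) n
  -- Putting the deviation at `hstar` into F avoids a union bound. It has mean 0 and differences at
  -- most 1/n, so F has mean 2R and differences at most 2/n.
  set F : (Fin n → X × Y) → ℝ := fun z => W z + (empiricalRisk z hstar - expectedRisk P hstar)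
    with hF
  have hFm : Measurable F := hWm.add (hem.sub_const _)
  have hFB : ∀ z, |F z| ≤ 2 + (1 + |expectedRisk P hstar|) := fun z =>
    (abs_add_le _ _).trans (add_le_add (hWB z) ((abs_sub _ _).trans
      (add_le_add_left (abs_empiricalRisk_le z hstar) _)))
  have hFL : ∀ z ∈ S, ∀ z' ∈ S, F z ≤ F z' + hammingCost (2 / (n : ℝ)) z z' := by
    intro z hz z' hz'
    have h1 := hWL z hz z' hz'
    have h2 := lossCorrelation_le_add_hammingCost (one_mem_signVectors n) z z' hstar
    rw [← empiricalRisk_eq_lossCorrelation, ← empiricalRisk_eq_lossCorrelation] at h2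
    have h3 : hammingCost (2 / (n : ℝ)) z z' = 2 * hammingCost (1 / (n : ℝ)) z z' := by
      rw [hammingCost_eq_mul, hammingCost_eq_mul (1 / (n : ℝ))]; ring
    simp only [hF, h3]
    linarith
  have hFi : ∫ z, F z ∂(Measure.pi fun _ => ν) = 2 * rademacher H n P := by
    have hi : Integrable (fun w : Fin n → X × Y => empiricalRisk w hstar)
        (Measure.pi fun _ => ν) :=
      integrable_of_abs_le _ hem fun w => abs_empiricalRisk_le w hstar
    have h1 := integral_add (integrable_of_abs_le (Measure.pi fun _ : Fin n => ν) hWm hWB)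
      (hi.sub (integrable_const (expectedRisk P hstar)))
    have h2 := integral_sub hi (integrable_const (expectedRisk P hstar))
    rw [integral_empiricalRisk (hH _ hstar_mem) hn P] at h2
    refine h1.trans ?_
    rw [hWi]
    simp only [Pi.sub_apply]
    rw [h2]
    simp
  have hlog : 0 ≤ Real.log (2 / δ) :=
    Real.log_nonneg (by rw [le_div_iff₀ hδ.1]; linarith [hδ.2])
  have htail := measureReal_ge_le_of_ae_boundedDifferences ν (c := 2 / (n : ℝ)) (by positivity) hn
    hFm hFB hS hFL (Real.sqrt_nonneg (2 * Real.log (2 / δ) / n))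
  -- With c = 2/n the exponent is -n s² / 2 = -log(2/δ), so the failure probability is at most δ/2,
  -- half of what is allowed.
  have hval : Real.exp (-2 * s ^ 2 / (n * (2 / (n : ℝ)) ^ 2)) = δ / 2 := by
    rw [hs, Real.sq_sqrt (by positivity)]
    have : -2 * (2 * Real.log (2 / δ) / n) / (n * (2 / (n : ℝ)) ^ 2) = -Real.log (2 / δ) := by
      field_simp
    rw [this, ← Real.log_inv, Real.exp_log (by have := hδ.1; positivity), inv_div]
  rw [hval, hFi] at htail
  have hZm : Measurable fun ω i => Z i ω := measurable_pi_lambda _ hZ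
  have hmap : μ.map (fun ω i => Z i ω) = Measure.pi fun _ => ν := by
    rw [(iIndepFun_iff_map_fun_eq_pi_map fun i => (hZ i).aemeasurable).1 hindep]
    simp_rw [hlaw]
  have hbad : MeasurableSet {z | 2 * rademacher H n P + s ≤ F z} :=
    measurableSet_le measurable_const hFm
  refine ⟨((fun ω i => Z i ω) ⁻¹' {z | 2 * rademacher H n P + s ≤ F z})ᶜ,
    (hZm hbad).compl, ?_, ?_⟩
  · intro ω hω
    -- L(ĥ) is at most W plus the empirical risk of ĥ, hence at most W plus that of `hstar`, which
    -- is F plus L(`hstar`).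
    have h1 : F (fun i => Z i ω) < 2 * rademacher H n P + s := not_le.1 hω
    have h2 := hWge (fun i => Z i ω) (hhat ω) (hhat_erm ω).1
    have h3 := (hhat_erm ω).2 hstar hstar_mem
    simp only [hF] at h1
    simp only [Set.mem_ofPred_eq]
    linarith
  · rw [probReal_compl_eq_one_sub (hZm hbad), ← map_measureReal_apply hZm hbad, hmap]
    linarith [hδ.1]

end CredalLearning

theorem mainTheorem12 {X Y : Type*} [MeasurableSpace X] [MeasurableSpace Y]
    -- hypotheses space, with a measurable loss for each hypothesis
    (H : Set (X → Y))
    (hH : ∀ h ∈ H, Measurable fun z : X × Y => CredalLearning.zeroOneLoss z h)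
    -- the credal set is the singleton consisting of the true distribution
    (Ptrue : ProbabilityMeasure (X × Y)) (C : Set (ProbabilityMeasure (X × Y)))
    (hC : C = {Ptrue})
    -- the random variable whose expectation is the Rademacher complexity is measurable
    (n : ℕ) (hn : 0 < n)
    (hR : AEMeasurable (CredalLearning.rademacherSup H n)
      (CredalLearning.signSampleLaw n Ptrue))
    -- an i.i.d. sample of size `n` from the true distribution
    {Ω : Type*} [MeasurableSpace Ω] (μ : Measure Ω) [IsProbabilityMeasure μ]
    (Z : Fin n → Ω → X × Y) (hZ : ∀ i, Measurable (Z i)) (hindep : iIndepFun Z μ)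
    (hlaw : ∀ i, μ.map (Z i) = (Ptrue : Measure (X × Y)))
    -- an empirical risk minimizer and a best theoretical model
    (hhat : Ω → X → Y) (hhat_erm : ∀ ω, CredalLearning.IsERM H (fun i => Z i ω) (hhat ω))
    (hstar : X → Y) (hstar_best : CredalLearning.IsBestModel H Ptrue hstar)
    (δ : ℝ) (hδ : δ ∈ Set.Ioo (0 : ℝ) 1) :
    CredalLearning.IsCredalSet C ∧
    CredalLearning.extremeElements C = {Ptrue} ∧
    CredalLearning.upperRademacher H n C = CredalLearning.rademacher H n Ptrue ∧
    CredalLearning.credalBound H n C δ =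
      4 * CredalLearning.rademacher H n Ptrue + Real.sqrt (2 * Real.log (2 / δ) / n) ∧
    CredalLearning.HoldsWithProb μ (1 - δ)
      {ω | CredalLearning.expectedRisk Ptrue (hhat ω) - CredalLearning.expectedRisk Ptrue hstar ≤
        CredalLearning.credalBound H n C δ} ∧
    CredalLearning.HoldsWithProb μ (1 - δ)
      {ω | CredalLearning.expectedRisk Ptrue (hhat ω) - CredalLearning.expectedRisk Ptrue hstar ≤
        4 * CredalLearning.rademacher H n Ptrue + Real.sqrt (2 * Real.log (2 / δ) / n)} := by
  subst hC
  have hup := CredalLearning.upperRademacher_singleton H n Ptrue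
  have hb : CredalLearning.credalBound H n {Ptrue} δ =
      4 * CredalLearning.rademacher H n Ptrue + Real.sqrt (2 * Real.log (2 / δ) / n) := by
    rw [CredalLearning.credalBound, hup]
  have hprob : CredalLearning.HoldsWithProb μ (1 - δ)
      {ω | CredalLearning.expectedRisk Ptrue (hhat ω) - CredalLearning.expectedRisk Ptrue hstar ≤
        4 * CredalLearning.rademacher H n Ptrue + Real.sqrt (2 * Real.log (2 / δ) / n)} := by
    -- The bound with 2R implies the one with 4R because R ≥ 0.
    refine (CredalLearning.holdsWithProb_excessRisk_le hH hn hR hZ hindep hlaw hhat_erm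
      hstar_best.1 hδ).mono fun ω hω => ?_
    have := CredalLearning.rademacher_nonneg ⟨hstar, hstar_best.1⟩ hH hn hR
    simp only [Set.mem_ofPred_eq] at hω ⊢
    linarith
  refine ⟨CredalLearning.isCredalSet_singleton Ptrue,
    CredalLearning.extremeElements_singleton Ptrue, hup, hb, ?_, hprob⟩
  rw [hb]
  exact hprob
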